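/- Let $(Z,d)$ be a compact metric space with a Borel measure $\nu$ that is Ahlfors $Q$-regular with constant $A>0$, where $Q>0$: $r^Q/A\le \nu(B(x,r))\le A\,r^Q$ for all $x\in Z$ and $0<r<2\operatorname{diam}(Z)$. Let $1<p<\infty$ and $0<\theta<1$. For $u\in L^p(Z,\nu)$ put $$\|u\|_{B^\theta_{p,p}(Z)}^p=\int_Z\int_Z\frac{|u(x)-u(z)|^p}{d(x,z)^{\theta p}\,\nu(B(x,d(x,z)))}\,d\nu(z)\,d\nu(x),$$ let $B^\theta_{p,p}(Z)$ be the set of $u\in L^p(Z,\nu)$ for which this is finite, and for $E,F\subset Z$ let $$\operatorname{cap}_{B^\theta_{p,p}(Z)}(E,F)=\inf_u\|u\|^p_{B^\theta_{p,p}(Z)},$$ the infimum being over all $u\in B^\theta_{p,p}(Z)$ with $u\ge1$ in a neighborhood of $E$ and $u\le 0$ in a neighborhood of $F$. Theorem. There are an absolute constant $C_0>2$ and a constant $c>0$ depending only on $Q$, $p$, $\theta$ and $A$ such that, for every such $Z$ and $\nu$, all $x_0\in Z$ and all $0<r<R<\operatorname{diam}(Z)/(4C_0)$, the capacity $$\kappa=\operatorname{cap}_{B^\theta_{p,p}(Z)}\bigl(\overline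 B(x_0,r),\,Z\setminus B(x_0,R)\bigr)$$ satisfies: 1. if $p\theta>Q$, then $\kappa\ge c\,R^{Q-\theta p}$; 2. if $p\theta=Q$ and $r\le R/2$, then $\kappa\ge c\,\log(R/r)^{1-p}$; 3. if $p\theta<Q$, then $\kappa\ge c\,r^{Q-\theta p}$. Here $B(x,r)$ and $\overline B(x,r)=\{z: d(x,z)\le r\}$ denote open and closed balls. -/

import Mathlib

open MeasureTheory Set Filter Topology

open scoped ENNReal

/-- The measure `ν` is Ahlfors `Q`-regular with constant `A`:
`r ^ Q / A ≤ ν (B(x, r)) ≤ A * r ^ Q` for all `x` and all `0 < r < 2 diam Z` (open balls). -/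
def IsAhlforsRegular {Z : Type*} [MetricSpace Z] [MeasurableSpace Z]
    (ν : Measure Z) (Q A : ℝ) : Prop :=
  0 < A ∧ ∀ (x : Z) (r : ℝ), 0 < r → r < 2 * Metric.diam (univ : Set Z) →
    ENNReal.ofReal (r ^ Q / A) ≤ ν (Metric.ball x r) ∧
      ν (Metric.ball x r) ≤ ENNReal.ofReal (A * r ^ Q)

/-- The `p`-th power of the Besov seminorm of `u`, with values in `[0, ∞]`:
`∫ ∫ |u x - u z| ^ p / (d(x, z) ^ (θ p) * ν (B(x, d(x, z)))) dν(z) dν(x)`.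
On the diagonal the integrand is `0 / 0 = 0`. -/
noncomputable def besovEnergy {Z : Type*} [MetricSpace Z] [MeasurableSpace Z]
    (ν : Measure Z) (θ p : ℝ) (u : Z → ℝ) : ℝ≥0∞ :=
  ∫⁻ x, ∫⁻ z, ENNReal.ofReal (|u x - u z| ^ p) /
    (ENNReal.ofReal (dist x z ^ (θ * p)) * ν (Metric.ball x (dist x z))) ∂ν ∂ν

/-- Membership in the Besov space `B^θ_{p,p}`: `u ∈ L^p` with finite Besov energy. -/
def MemBesov {Z : Type*} [MetricSpace Z] [MeasurableSpace Z]
    (ν : Measure Z) (θ p : ℝ) (u : Z → ℝ) : Prop :=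
  MemLp u (ENNReal.ofReal p) ν ∧ besovEnergy ν θ p u < ∞

/-- The relative Besov capacity of the condenser `(E, F)`: the infimum of the Besov energies of
all Besov functions `u` with `u ≥ 1` in a neighborhood of `E` and `u ≤ 0` in a neighborhood of `F`
(with value `∞` if there is no such function). -/
noncomputable def besovCapacity {Z : Type*} [MetricSpace Z] [MeasurableSpace Z]
    (ν : Measure Z) (θ p : ℝ) (E F : Set Z) : ℝ≥0∞ :=
  ⨅ (u : Z → ℝ) (_ : MemBesov ν θ p u) (_ : ∀ᶠ x in 𝓝ˢ E, 1 ≤ u x)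
    (_ : ∀ᶠ x in 𝓝ˢ F, u x ≤ 0), besovEnergy ν θ p u

/-! Fix a large ratio `l` and compare the averages of an admissible `u` over the annuli `S k` about
`x₀` with inner radius `ρ k = R / l ^ k` and outer radius `l * ρ k`. The average is at most 0 on `S
0`, which lies outside the ball of radius `R`, and at least 1 on `S M` once that annulus lies in the
closed ball of radius `r`. So the jumps between consecutive averages sum to at least 1. By Jensen
and Ahlfors regularity, the `p`-th power of the `k`-th jump is at most `C * ρ k ^ (θ * p - Q) * e
k`, where `e k` is the energy on `S k × S (k + 1)`. The annuli are disjoint, so the `e k` sum to at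
most the energy of `u`. Off the critical exponent, bounding each `e k` by the total leaves a
geometric series governed by its largest or smallest radius. At the critical exponent the weights
are constant, and Hölder over about `log (R / r)` annuli gives the logarithm. -/

/-! ### Averages and Jensen's inequality -/

/-- Jensen's inequality for `t ↦ |a - t| ^ p`. -/
theorem enorm_sub_integral_rpow_le {X : Type*} [MeasurableSpace X] (μ : Measure X)
    [IsProbabilityMeasure μ] {p : ℝ} (hp : 1 ≤ p) {u : X → ℝ} (hu : Integrable u μ) (a : ℝ) :
    ‖a - ∫ z, u z ∂μ‖ₑ ^ p ≤ ∫⁻ z, ‖a - u z‖ₑ ^ p ∂μ := by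
  have hp0 : 0 < p := by linarith
  have hi : Integrable (fun z => a - u z) μ := (integrable_const a).sub hu
  have h1 : a - ∫ z, u z ∂μ = ∫ z, (a - u z) ∂μ := by
    rw [integral_sub (integrable_const a) hu]; simp
  have h2 : ‖a - ∫ z, u z ∂μ‖ₑ ≤ eLpNorm (fun z => a - u z) 1 μ := by
    rw [h1, eLpNorm_one_eq_lintegral_enorm]
    exact enorm_integral_le_lintegral_enorm _
  have h3 : eLpNorm (fun z => a - u z) 1 μ ≤ eLpNorm (fun z => a - u z) (ENNReal.ofReal p) μ :=
    eLpNorm_le_eLpNorm_of_exponent_le (by simpa using hp) hi.aestronglyMeasurable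
  have h4 := ENNReal.rpow_le_rpow (h2.trans h3) hp0.le
  refine h4.trans (le_of_eq ?_)
  rw [eLpNorm_eq_lintegral_rpow_enorm_toReal (by simpa using hp0) (by simp),
    ENNReal.toReal_ofReal hp0.le, ← ENNReal.rpow_mul]
  field_simp
  simp

open ProbabilityTheory in
theorem lintegral_cond {X : Type*} [MeasurableSpace X] (ν : Measure X) (S : Set X)
    (f : X → ℝ≥0∞) : ∫⁻ x, f x ∂(cond ν S) = (ν S)⁻¹ * ∫⁻ x in S, f x ∂ν := by
  simp [ProbabilityTheory.cond, lintegral_smul_measure]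

open ProbabilityTheory in
/-- The difference of two averages is controlled by the double integral of differences. -/
theorem enorm_average_sub_rpow_le {X : Type*} [MeasurableSpace X] (ν : Measure X)
    [IsFiniteMeasure ν] {p : ℝ} (hp : 1 ≤ p) {u : X → ℝ} (hu : Integrable u ν)
    {S T : Set X} (hS : ν S ≠ 0) (hT : ν T ≠ 0) :
    ‖(∫ x, u x ∂(cond ν S)) - ∫ z, u z ∂(cond ν T)‖ₑ ^ p ≤
      (ν S)⁻¹ * (ν T)⁻¹ * ∫⁻ x in S, ∫⁻ z in T, ‖u x - u z‖ₑ ^ p ∂ν ∂ν := by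
  have : IsProbabilityMeasure (cond ν S) := cond_isProbabilityMeasure hS
  have : IsProbabilityMeasure (cond ν T) := cond_isProbabilityMeasure hT
  have hi (W : Set X) (hW : ν W ≠ 0) : Integrable u (cond ν W) :=
    (hu.restrict).smul_measure (by simpa using hW)
  have hsymm (a b : ℝ) : ‖a - b‖ₑ = ‖b - a‖ₑ := by
    rw [Real.enorm_eq_ofReal_abs, Real.enorm_eq_ofReal_abs, abs_sub_comm]
  rw [hsymm]
  refine (enorm_sub_integral_rpow_le _ hp (hi S hS) _).trans ?_
  rw [lintegral_cond, mul_assoc]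
  gcongr
  -- A finite constant moves inside the integral without any measurability of the inner integral.
  rw [← lintegral_const_mul' _ _ (by simpa using hT)]
  gcongr with x
  rw [hsymm, ← lintegral_cond]
  exact enorm_sub_integral_rpow_le _ hp (hi T hT) _

/-! ### Consequences of Ahlfors regularity -/

/-- The integrand of `besovEnergy`. -/
noncomputable def besovKernel {Z : Type*} [MetricSpace Z] [MeasurableSpace Z]
    (ν : Measure Z) (θ p : ℝ) (u : Z → ℝ) (x z : Z) : ℝ≥0∞ :=
  ENNReal.ofReal (|u x - u z| ^ p) /
    (ENNReal.ofReal (dist x z ^ (θ * p)) * ν (Metric.ball x (dist x z)))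

theorem dist_le_diam_univ {Z : Type*} [MetricSpace Z] [CompactSpace Z] (x y : Z) :
    dist x y ≤ Metric.diam (univ : Set Z) :=
  Metric.dist_le_diam_of_mem isCompact_univ.isBounded (mem_univ x) (mem_univ y)

section

variable {Z : Type*} [MetricSpace Z] [CompactSpace Z] [MeasurableSpace Z]
  {ν : Measure Z} {Q A : ℝ}

/-- Upper regularity bounds the kernel's denominator by `A * d ^ (θ * p + Q)` with `d = dist x z`,
and this increases with `d`. -/
theorem enorm_sub_rpow_le_besovKernel (hν : IsAhlforsRegular ν Q A) (hQ : 0 < Q) {θ p : ℝ}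
    (hp : 0 < p) (hθ : 0 < θ) (u : Z → ℝ) {x z : Z} {D : ℝ} (hD : 0 < D) (h : dist x z ≤ D) :
    ‖u x - u z‖ₑ ^ p ≤ ENNReal.ofReal (A * D ^ (θ * p + Q)) * besovKernel ν θ p u x z := by
  have hA := hν.1
  rcases eq_or_ne x z with rfl | hne
  · simp [ENNReal.zero_rpow_of_pos hp]
  have hd : 0 < dist x z := dist_pos.2 hne
  have hball := (hν.2 x (dist x z) hd (by linarith [dist_le_diam_univ x z])).2
  have hw : ENNReal.ofReal (dist x z ^ (θ * p)) * ν (Metric.ball x (dist x z)) ≤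
      ENNReal.ofReal (A * D ^ (θ * p + Q)) := by
    calc _ ≤ ENNReal.ofReal (dist x z ^ (θ * p)) * ENNReal.ofReal (A * dist x z ^ Q) := by gcongr
      _ = ENNReal.ofReal (A * dist x z ^ (θ * p + Q)) := by
        rw [← ENNReal.ofReal_mul (by positivity), Real.rpow_add hd]; ring_nf
      _ ≤ _ := by gcongr
  have hK0 : ENNReal.ofReal (A * D ^ (θ * p + Q)) ≠ 0 := by
    simp only [ne_eq, ENNReal.ofReal_eq_zero, not_le]; positivity
  unfold besovKernel
  rw [Real.enorm_eq_ofReal_abs, ENNReal.ofReal_rpow_of_nonneg (abs_nonneg _) hp.le]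
  calc _ = ENNReal.ofReal (A * D ^ (θ * p + Q)) *
        (ENNReal.ofReal (|u x - u z| ^ p) / ENNReal.ofReal (A * D ^ (θ * p + Q))) :=
        (ENNReal.mul_div_cancel hK0 ENNReal.ofReal_ne_top).symm
    _ ≤ _ := by gcongr

theorem IsAhlforsRegular.isFiniteMeasure (hν : IsAhlforsRegular ν Q A)
    (hd : 0 < Metric.diam (univ : Set Z)) (x : Z) : IsFiniteMeasure ν := by
  -- A radius strictly between the diameter and twice the diameter: admissible in the regularity
  -- condition, and its open ball is all of `Z`.
  have h := (hν.2 x (3 / 2 * Metric.diam (univ : Set Z)) (by linarith) (by linarith)).2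
  refine ⟨lt_of_le_of_lt (measure_mono fun y _ => ?_) (h.trans_lt ENNReal.ofReal_lt_top)⟩
  rw [Metric.mem_ball]
  linarith [dist_le_diam_univ y x]

/-- Annuli of sufficiently large aspect ratio carry a proportional amount of mass. -/
theorem IsAhlforsRegular.le_measure_annulus [BorelSpace Z] (hν : IsAhlforsRegular ν Q A)
    {l : ℝ} (hl : 2 ≤ l) (hlQ : A ^ 2 + 1 ≤ l ^ Q) (x : Z) {ρ : ℝ} (hρ : 0 < ρ)
    (hd : 12 * ρ < Metric.diam (univ : Set Z)) :
    ENNReal.ofReal (ρ ^ Q / A) ≤ ν (Metric.ball x (l * ρ) \ Metric.ball x ρ) := by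
  have hA := hν.1
  rcases lt_or_ge (l * ρ) (2 * Metric.diam (univ : Set Z)) with h | h
  -- Subtracting the two regularity bounds leaves `(l ^ Q / A - A) * ρ ^ Q`, and `A ^ 2 + 1 ≤ l ^ Q`
  -- makes the factor at least `1 / A`.
  · have h1 := (hν.2 x (l * ρ) (by positivity) h).1
    have h2 := (hν.2 x ρ hρ (by linarith)).2
    refine le_trans ?_ le_measure_sdiff
    refine le_trans ?_ (tsub_le_tsub h1 h2)
    rw [← ENNReal.ofReal_sub _ (by positivity)]
    apply ENNReal.ofReal_le_ofReal
    rw [Real.mul_rpow (by linarith) hρ.le]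
    have hρQ : 0 < ρ ^ Q := by positivity
    rw [div_le_iff₀ hA, sub_mul, div_mul_cancel₀ _ hA.ne']
    nlinarith
  -- Here the outer ball is all of `Z`, so it suffices to find a ball of radius `ρ` disjoint from
  -- the inner one.
  · obtain ⟨y, hy⟩ : ∃ y, 2 * ρ ≤ dist y x := by
      by_contra! hcon
      have : Metric.diam (univ : Set Z) ≤ 4 * ρ :=
        Metric.diam_le_of_forall_dist_le (by positivity) fun a _ b _ => by
          linarith [dist_triangle_right a b x, hcon a, hcon b]
      linarith
    refine (hν.2 y ρ hρ (by linarith)).1.trans (measure_mono fun w hw => ⟨?_, ?_⟩)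
    · rw [Metric.mem_ball]
      linarith [dist_le_diam_univ w x]
    · rw [Metric.mem_ball] at hw ⊢
      linarith [dist_triangle_left y x w]

/-! ### Telescoping over annuli -/

open ProbabilityTheory in
/-- Averages over two consecutive annuli differ by at most the energy between them. -/
theorem abs_average_annulus_sub_rpow_le [BorelSpace Z] [IsFiniteMeasure ν]
    (hν : IsAhlforsRegular ν Q A)
    (hQ : 0 < Q) {θ p : ℝ} (hp : 1 < p) (hθ : 0 < θ) {u : Z → ℝ} (hu : Integrable u ν)
    {S T : Set Z} {ρ l : ℝ} (hρ : 0 < ρ) (hl : 0 < l)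
    (hS : ENNReal.ofReal (ρ ^ Q / A) ≤ ν S)
    (hT : ENNReal.ofReal ((ρ / l) ^ Q / A) ≤ ν T)
    (hST : ∀ x ∈ S, ∀ z ∈ T, dist x z ≤ 2 * l * ρ)
    (hSm : MeasurableSet S) (hTm : MeasurableSet T)
    (he : ∫⁻ x in S, ∫⁻ z in T, besovKernel ν θ p u x z ∂ν ∂ν ≠ ∞) :
    |(∫ x, u x ∂(cond ν S)) - ∫ z, u z ∂(cond ν T)| ^ p ≤
      A ^ 3 * (2 * l) ^ (θ * p + Q) * l ^ Q * ρ ^ (θ * p - Q) *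
        (∫⁻ x in S, ∫⁻ z in T, besovKernel ν θ p u x z ∂ν ∂ν).toReal := by
  have hA := hν.1
  have hp0 : 0 < p := by linarith
  have hpos {W : Set Z} {t : ℝ} (ht : 0 < t) (h : ENNReal.ofReal t ≤ ν W) : ν W ≠ 0 :=
    (lt_of_lt_of_le (ENNReal.ofReal_pos.2 ht) h).ne'
  have hinv {W : Set Z} {t : ℝ} (ht : 0 < t) (h : ENNReal.ofReal t ≤ ν W) :
      (ν W)⁻¹ ≤ ENNReal.ofReal t⁻¹ := by
    rw [ENNReal.ofReal_inv_of_pos ht]; exact ENNReal.inv_le_inv.2 h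
  have hS0 : 0 < ρ ^ Q / A := by positivity
  have hT0 : 0 < (ρ / l) ^ Q / A := by positivity
  set e := ∫⁻ x in S, ∫⁻ z in T, besovKernel ν θ p u x z ∂ν ∂ν with hedef
  have key : ∫⁻ x in S, ∫⁻ z in T, ‖u x - u z‖ₑ ^ p ∂ν ∂ν ≤
      ENNReal.ofReal (A * (2 * l * ρ) ^ (θ * p + Q)) * e := by
    rw [hedef, ← lintegral_const_mul' _ _ ENNReal.ofReal_ne_top]
    refine setLIntegral_mono' hSm fun x hx => ?_
    rw [← lintegral_const_mul' _ _ ENNReal.ofReal_ne_top]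
    exact setLIntegral_mono' hTm fun z hz =>
      enorm_sub_rpow_le_besovKernel hν hQ hp0 hθ u (by positivity) (hST x hx z hz)
  have h1 : ‖(∫ x, u x ∂(cond ν S)) - ∫ z, u z ∂(cond ν T)‖ₑ ^ p ≤
      ENNReal.ofReal (A ^ 3 * (2 * l) ^ (θ * p + Q) * l ^ Q * ρ ^ (θ * p - Q) * e.toReal) := by
    calc _ ≤ (ν S)⁻¹ * (ν T)⁻¹ * ∫⁻ x in S, ∫⁻ z in T, ‖u x - u z‖ₑ ^ p ∂ν ∂ν :=
          enorm_average_sub_rpow_le ν hp.le hu (hpos hS0 hS) (hpos hT0 hT)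
      _ ≤ ENNReal.ofReal (ρ ^ Q / A)⁻¹ * ENNReal.ofReal ((ρ / l) ^ Q / A)⁻¹ *
          (ENNReal.ofReal (A * (2 * l * ρ) ^ (θ * p + Q)) * ENNReal.ofReal e.toReal) := by
        rw [ENNReal.ofReal_toReal he]
        gcongr
        exacts [hinv hS0 hS, hinv hT0 hT]
      _ = _ := by
        rw [← ENNReal.ofReal_mul (by positivity), ← ENNReal.ofReal_mul (by positivity),
          ← ENNReal.ofReal_mul (by positivity)]
        congr 1
        rw [Real.mul_rpow (by positivity) hρ.le, Real.div_rpow hρ.le hl.le, Real.rpow_sub hρ,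
          Real.rpow_add hρ]
        field_simp
  rw [Real.enorm_eq_ofReal_abs, ENNReal.ofReal_rpow_of_nonneg (abs_nonneg _) hp0.le] at h1
  exact (ENNReal.ofReal_le_ofReal_iff (by positivity)).1 h1

open ProbabilityTheory in
/-- Telescoping along annuli with radii `R / l ^ k`. -/
theorem exists_energy_decomposition [BorelSpace Z]
    (hν : IsAhlforsRegular ν Q A) (hQ : 0 < Q) {θ p : ℝ} (hp : 1 < p) (hθ : 0 < θ)
    {l : ℝ} (hl : 2 ≤ l) (hlQ : A ^ 2 + 1 ≤ l ^ Q)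
    {x₀ : Z} {r R : ℝ} (hR : 0 < R) (hd : 12 * R < Metric.diam (univ : Set Z))
    {u : Z → ℝ} (hu : MemBesov ν θ p u) (hE : ∀ x ∈ Metric.closedBall x₀ r, 1 ≤ u x)
    (hF : ∀ x ∈ (Metric.ball x₀ R)ᶜ, u x ≤ 0) {M : ℕ} (hM : l * (R / l ^ M) ≤ r) :
    ∃ e : ℕ → ℝ, (∀ k, 0 ≤ e k) ∧ (∑ k ∈ Finset.range M, e k) ≤ (besovEnergy ν θ p u).toReal ∧
      1 ≤ ∑ k ∈ Finset.range M, (A ^ 3 * (2 * l) ^ (θ * p + Q) * l ^ Q *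
        (R / l ^ k) ^ (θ * p - Q) * e k) ^ p⁻¹ := by
  have hl0 : 0 < l := by linarith
  have hp0 : 0 < p := by linarith
  have hA := hν.1
  have : IsFiniteMeasure ν := hν.isFiniteMeasure (by linarith) x₀
  have hui : Integrable u ν := hu.1.integrable (by simpa using hp.le)
  set ρ : ℕ → ℝ := fun k => R / l ^ k with hρdef
  have hρ0 (k) : 0 < ρ k := by positivity
  have hρs (k) : ρ (k + 1) = ρ k / l := by simp only [hρdef]; rw [pow_succ]; field_simp
  have hρl (k) : l * ρ (k + 1) = ρ k := by rw [hρs]; field_simp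
  have hanti : Antitone ρ := antitone_nat_of_succ_le fun k => by
    rw [← hρl k]; nlinarith [hρ0 (k + 1)]
  have hρR (k) : ρ k ≤ R := by simpa [hρdef] using hanti (Nat.zero_le k)
  set S : ℕ → Set Z := fun k => Metric.ball x₀ (l * ρ k) \ Metric.ball x₀ (ρ k) with hSdef
  have hSm (k) : MeasurableSet (S k) := measurableSet_ball.diff measurableSet_ball
  have hSν (k) : ENNReal.ofReal (ρ k ^ Q / A) ≤ ν (S k) :=
    hν.le_measure_annulus hl hlQ x₀ (hρ0 k) (by linarith [hρR k])
  have hSdisj : Pairwise (fun i j => Disjoint (S i) (S j)) := by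
    have aux : ∀ i j, i < j → Disjoint (S i) (S j) := fun i j hij => by
      rw [Set.disjoint_left]
      rintro x ⟨-, hx⟩ ⟨hx', -⟩
      obtain ⟨k, rfl⟩ : ∃ k, j = k + 1 := ⟨j - 1, by omega⟩
      rw [hρl] at hx'
      exact hx (Metric.ball_subset_ball (hanti (by omega)) hx')
    intro i j hij
    rcases lt_or_gt_of_ne hij with h | h
    exacts [aux i j h, (aux j i h).symm]
  set e : ℕ → ℝ≥0∞ := fun k =>
    ∫⁻ x in S k, ∫⁻ z in S (k + 1), besovKernel ν θ p u x z ∂ν ∂ν with hedef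
  -- Disjointness in the first variable alone suffices; the second variable is enlarged to all of
  -- `Z`.
  have hsum : ∑ k ∈ Finset.range M, e k ≤ besovEnergy ν θ p u := by
    calc _ ≤ ∑ k ∈ Finset.range M, ∫⁻ x in S k, ∫⁻ z, besovKernel ν θ p u x z ∂ν ∂ν := by
          gcongr with k
          exact lintegral_mono fun x => setLIntegral_le_lintegral _ _
      _ = ∫⁻ x in ⋃ k ∈ Finset.range M, S k, ∫⁻ z, besovKernel ν θ p u x z ∂ν ∂ν :=
          (lintegral_biUnion_finset (fun i _ j _ hij => hSdisj hij) (fun k _ => hSm k) _).symm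
      _ ≤ _ := setLIntegral_le_lintegral _ _
  have htop (k) : e k ≠ ∞ := by
    refine ne_top_of_le_ne_top hu.2.ne ?_
    exact (lintegral_mono fun x => setLIntegral_le_lintegral _ _).trans
      (setLIntegral_le_lintegral _ _)
  refine ⟨fun k => (e k).toReal, fun k => ENNReal.toReal_nonneg, ?_, ?_⟩
  · rw [← ENNReal.toReal_sum fun k _ => htop k]
    exact ENNReal.toReal_mono hu.2.ne hsum
  set a : ℕ → ℝ := fun k => ∫ x, u x ∂(cond ν (S k)) with hadef
  have hne (k) : ν (S k) ≠ 0 :=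
    (lt_of_lt_of_le (ENNReal.ofReal_pos.2 (by have := hρ0 k; positivity)) (hSν k)).ne'
  have hprob (k) : IsProbabilityMeasure (cond ν (S k)) := cond_isProbabilityMeasure (hne k)
  have hint (k) : Integrable u (cond ν (S k)) :=
    (hui.restrict).smul_measure (by simpa using hne k)
  have hmem (k) : ∀ᵐ x ∂(cond ν (S k)), x ∈ S k := ae_cond_mem (hSm k)
  have ha0 : a 0 ≤ 0 := by
    refine integral_nonpos_of_ae ((hmem 0).mono fun x hx => hF x ?_)
    simpa [hSdef, hρdef] using hx.2
  have haM : 1 ≤ a M := by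
    have h := integral_mono_ae (integrable_const (1 : ℝ)) (hint M)
      ((hmem M).mono fun x hx => hE x (Metric.ball_subset_closedBall
        (Metric.ball_subset_ball hM hx.1)))
    simpa using h
  calc (1 : ℝ) ≤ a M - a 0 := by linarith
    _ = ∑ k ∈ Finset.range M, (a (k + 1) - a k) := (Finset.sum_range_sub a M).symm
    _ ≤ _ := by
      gcongr with k
      refine (le_abs_self _).trans ?_
      rw [abs_sub_comm]
      have h := abs_average_annulus_sub_rpow_le hν hQ hp hθ hui (hρ0 k) hl0 (hSν k)
        (by rw [← hρs]; exact hSν (k + 1)) ?_ (hSm k) (hSm (k + 1)) (htop k)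
      · have h' := Real.rpow_le_rpow (by positivity) h (inv_nonneg.2 hp0.le)
        rwa [Real.rpow_rpow_inv (abs_nonneg _) hp0.ne'] at h'
      · intro x hx z hz
        have h1 := Metric.mem_ball.1 hx.1
        have h2 := Metric.mem_ball.1 hz.1
        rw [hρl] at h2
        nlinarith [dist_triangle_right x z x₀, hρ0 k]

/-- Reduces each regime to an inequality about finitely many nonnegative reals. -/
theorem le_besovCapacity [BorelSpace Z]
    (hν : IsAhlforsRegular ν Q A) (hQ : 0 < Q) {θ p : ℝ} (hp : 1 < p) (hθ : 0 < θ)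
    {l : ℝ} (hl : 2 ≤ l) (hlQ : A ^ 2 + 1 ≤ l ^ Q)
    {x₀ : Z} {r R : ℝ} (hR : 0 < R) (hd : 12 * R < Metric.diam (univ : Set Z))
    {M : ℕ} (hM : l * (R / l ^ M) ≤ r) {X : ℝ}
    (hX : ∀ (e : ℕ → ℝ) (E : ℝ), (∀ k, 0 ≤ e k) → (∑ k ∈ Finset.range M, e k) ≤ E →
      1 ≤ ∑ k ∈ Finset.range M, (A ^ 3 * (2 * l) ^ (θ * p + Q) * l ^ Q *
        (R / l ^ k) ^ (θ * p - Q) * e k) ^ p⁻¹ → X ≤ E) :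
    ENNReal.ofReal X ≤
      besovCapacity ν θ p (Metric.closedBall x₀ r) (Metric.ball x₀ R)ᶜ := by
  refine le_iInf₂ fun u hu => le_iInf₂ fun hE hF => ?_
  obtain ⟨e, h0, h1, h2⟩ := exists_energy_decomposition hν hQ hp hθ hl hlQ hR hd hu
    (fun x hx => (eventually_nhdsSet_iff_forall.1 hE x hx).self_of_nhds)
    (fun x hx => (eventually_nhdsSet_iff_forall.1 hF x hx).self_of_nhds) hM
  exact ENNReal.ofReal_le_of_le_toReal (hX e _ h0 h1 h2)

end

/-! ### Numerical inequalities -/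

/-- For the noncritical regimes: replacing every `e k` by `E` loses only a constant when the weights
sum geometrically. -/
theorem inv_le_of_one_le_sum_rpow {p t C E B : ℝ} (hp : 1 < p) (hC : 0 < C) (hB : 0 < B)
    {M : ℕ} {ρ e : ℕ → ℝ} (hρ : ∀ k, 0 < ρ k) (he : ∀ k, 0 ≤ e k)
    (hE : ∑ k ∈ Finset.range M, e k ≤ E)
    (h : 1 ≤ ∑ k ∈ Finset.range M, (C * ρ k ^ t * e k) ^ p⁻¹)
    (hsum : ∑ k ∈ Finset.range M, ρ k ^ (t / p) ≤ B) : (C * B ^ p)⁻¹ ≤ E := by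
  have hp0 : 0 < p := by linarith
  have hE0 : 0 ≤ E := (Finset.sum_nonneg fun k _ => he k).trans hE
  have h1 : 1 ≤ (C * E) ^ p⁻¹ * B := by
    calc 1 ≤ ∑ k ∈ Finset.range M, (C * ρ k ^ t * e k) ^ p⁻¹ := h
      _ ≤ ∑ k ∈ Finset.range M, (C * E) ^ p⁻¹ * ρ k ^ (t / p) := by
        refine Finset.sum_le_sum fun k hk => ?_
        have hk' : e k ≤ E := (Finset.single_le_sum (fun i _ => he i) hk).trans hE
        have hρk := hρ k
        have hek := he k
        rw [div_eq_mul_inv, Real.rpow_mul hρk.le, ← Real.mul_rpow (by positivity) (by positivity)]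
        apply Real.rpow_le_rpow (by positivity) _ (by positivity)
        calc C * ρ k ^ t * e k ≤ C * ρ k ^ t * E := by gcongr
          _ = _ := by ring
      _ = (C * E) ^ p⁻¹ * ∑ k ∈ Finset.range M, ρ k ^ (t / p) := by rw [Finset.mul_sum]
      _ ≤ _ := by gcongr
  have h2 : 1 ≤ ((C * E) ^ p⁻¹ * B) ^ p := Real.one_le_rpow h1 hp0.le
  rw [Real.mul_rpow (by positivity) hB.le, Real.rpow_inv_rpow (by positivity) hp0.ne'] at h2
  rw [inv_le_iff_one_le_mul₀ (by positivity)]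
  linarith

/-- For the critical regime: the power mean inequality retains the sum of the `e k`, so the loss is
`M ^ (p - 1)` rather than `M ^ p`. -/
theorem inv_le_of_one_le_sum_rpow_inv {p C E b : ℝ} (hp : 1 < p) (hC : 0 < C)
    {M : ℕ} {e : ℕ → ℝ} (he : ∀ k, 0 ≤ e k) (hE : ∑ k ∈ Finset.range M, e k ≤ E) (hb : 0 < b)
    (h : 1 ≤ ∑ k ∈ Finset.range M, (C * e k) ^ p⁻¹) (hM : (M : ℝ) ≤ b) :
    (C * b ^ (p - 1))⁻¹ ≤ E := by
  have hp0 : 0 < p := by linarith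
  have hE0 : 0 ≤ E := (Finset.sum_nonneg fun k _ => he k).trans hE
  have hnn (k) : 0 ≤ C * e k := mul_nonneg hC.le (he k)
  have h1 := Real.rpow_sum_le_const_mul_sum_rpow_of_nonneg (Finset.range M)
    (f := fun k => (C * e k) ^ p⁻¹) hp.le (fun k _ => Real.rpow_nonneg (hnn k) _)
  simp only [Real.rpow_inv_rpow (hnn _) hp0.ne', Finset.card_range, ← Finset.mul_sum] at h1
  have h2 : (M : ℝ) ^ (p - 1) * (C * ∑ k ∈ Finset.range M, e k) ≤ b ^ (p - 1) * (C * E) := by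
    have : 0 ≤ p - 1 := by linarith
    have hsum : 0 ≤ ∑ k ∈ Finset.range M, e k := Finset.sum_nonneg fun k _ => he k
    gcongr
  rw [inv_le_iff_one_le_mul₀ (by positivity)]
  linarith [Real.one_le_rpow h hp0.le]

theorem sum_range_pow_le {q : ℝ} (h0 : 0 ≤ q) (h1 : q < 1) (n : ℕ) :
    ∑ k ∈ Finset.range n, q ^ k ≤ (1 - q)⁻¹ := by
  rw [← tsum_geometric_of_lt_one h0 h1]
  exact (summable_geometric_of_lt_one h0 h1).sum_le_tsum _ fun k _ => pow_nonneg h0 k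

theorem sum_rpow_div_pow_le_of_pos {l R s : ℝ} (hl : 1 < l) (hR : 0 < R) (hs : 0 < s) (n : ℕ) :
    ∑ k ∈ Finset.range n, (R / l ^ k) ^ s ≤ R ^ s * (1 - l ^ (-s))⁻¹ := by
  have hl0 : 0 < l := by linarith
  calc _ = R ^ s * ∑ k ∈ Finset.range n, (l ^ (-s)) ^ k := by
        rw [Finset.mul_sum]
        refine Finset.sum_congr rfl fun k _ => ?_
        rw [Real.div_rpow hR.le (by positivity), Real.rpow_neg hl0.le, inv_pow, ← Real.rpow_natCast,
          ← Real.rpow_natCast, ← Real.rpow_mul hl0.le, ← Real.rpow_mul hl0.le, mul_comm s,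
          div_eq_mul_inv]
    _ ≤ _ := by
        gcongr
        exact sum_range_pow_le (by positivity)
          (Real.rpow_lt_one_of_one_lt_of_neg hl (by linarith)) n

theorem sum_rpow_div_pow_le_of_neg {l R r s : ℝ} (hl : 1 < l) (hr : 0 < r) (hs : s < 0)
    {n : ℕ} (hn : r ≤ R / l ^ n) :
    ∑ k ∈ Finset.range (n + 1), (R / l ^ k) ^ s ≤ r ^ s * (1 - l ^ s)⁻¹ := by
  have hl0 : 0 < l := by linarith
  -- Reversing the order makes the smallest radius, whose term is largest as `s < 0`, come first.
  calc _ = ∑ k ∈ Finset.range (n + 1), (R / l ^ (n - k)) ^ s := by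
        rw [← Finset.sum_range_reflect]; simp
    _ ≤ ∑ k ∈ Finset.range (n + 1), r ^ s * (l ^ s) ^ k := by
        refine Finset.sum_le_sum fun k hk => ?_
        have hk' : k ≤ n := by simpa [Nat.lt_succ_iff] using hk
        have h1 : r * l ^ k ≤ R / l ^ (n - k) := by
          calc r * l ^ k ≤ R / l ^ n * l ^ k := by gcongr
            _ = _ := by
              have : l ^ n = l ^ (n - k) * l ^ k := by rw [← pow_add]; congr 1; omega
              rw [this]; field_simp
        refine (Real.rpow_le_rpow_of_nonpos (by positivity) h1 hs.le).trans (le_of_eq ?_)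
        rw [Real.mul_rpow hr.le (by positivity), ← Real.rpow_natCast, ← Real.rpow_natCast,
          ← Real.rpow_mul hl0.le, ← Real.rpow_mul hl0.le, mul_comm s]
    _ ≤ _ := by
        rw [← Finset.mul_sum]
        gcongr
        exact sum_range_pow_le (by positivity) (Real.rpow_lt_one_of_one_lt_of_neg hl hs) _

/-! ### The three regimes -/

theorem mainTheorem4 :
    ∃ C₀ : ℝ, 2 < C₀ ∧
      ∀ (Q p θ A : ℝ), 0 < Q → 1 < p → 0 < θ → θ < 1 → 0 < A →
        ∃ c : ℝ, 0 < c ∧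
          ∀ (Z : Type*) [MetricSpace Z] [CompactSpace Z] [MeasurableSpace Z] [BorelSpace Z]
            (ν : Measure Z), IsAhlforsRegular ν Q A →
            ∀ (x₀ : Z) (r R : ℝ), 0 < r → r < R →
              R < Metric.diam (univ : Set Z) / (4 * C₀) →
              (Q < p * θ →
                ENNReal.ofReal (c * R ^ (Q - θ * p)) ≤
                  besovCapacity ν θ p (Metric.closedBall x₀ r) (Metric.ball x₀ R)ᶜ) ∧
              (p * θ = Q → r ≤ R / 2 →
                ENNReal.ofReal (c * Real.log (R / r) ^ (1 - p)) ≤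
                  besovCapacity ν θ p (Metric.closedBall x₀ r) (Metric.ball x₀ R)ᶜ) ∧
              (p * θ < Q →
                ENNReal.ofReal (c * r ^ (Q - θ * p)) ≤
                  besovCapacity ν θ p (Metric.closedBall x₀ r) (Metric.ball x₀ R)ᶜ) := by
  -- With `C₀ = 3` the condition on `R` reads `12 * R < diam Z`, as the annulus estimate requires.
  refine ⟨3, by norm_num, fun Q p θ A hQ hp hθ _ hA => ?_⟩
  have hp0 : 0 < p := by linarith
  obtain ⟨l, hl, hlQ⟩ : ∃ l : ℝ, 2 ≤ l ∧ A ^ 2 + 1 ≤ l ^ Q :=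
    ((eventually_ge_atTop 2).and ((tendsto_rpow_atTop hQ).eventually_ge_atTop _)).exists
  have hl0 : 0 < l := by linarith
  have hl1 : 1 < l := by linarith
  set C : ℝ := A ^ 3 * (2 * l) ^ (θ * p + Q) * l ^ Q with hCdef
  have hC : 0 < C := by positivity
  have radius {r R : ℝ} (hr : 0 < r) (hrR : r < R) :
      ∃ n : ℕ, r ≤ R / l ^ n ∧ R / l ^ (n + 1) ≤ r := by
    obtain ⟨n, h1, h2⟩ := exists_nat_pow_near ((one_le_div hr).2 hrR.le) hl1
    refine ⟨n, ?_, ?_⟩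
    · rw [le_div_iff₀ hr] at h1
      rw [le_div_iff₀ (by positivity)]; linarith
    · rw [div_lt_iff₀ hr] at h2
      rw [div_le_iff₀ (by positivity)]; linarith
  -- Taking `M = n + 2` gives the last annulus outer radius `R / l ^ (n + 1) ≤ r`.
  have hlM (R : ℝ) (n : ℕ) : l * (R / l ^ (n + 1 + 1)) = R / l ^ (n + 1) := by
    rw [pow_succ _ (n + 1)]; field_simp
  rcases lt_trichotomy (p * θ) Q with hlt | heq | hgt
  · have hs : (θ * p - Q) / p < 0 := div_neg_of_neg_of_pos (by linarith) hp0
    have hg : 0 < (1 - l ^ ((θ * p - Q) / p))⁻¹ :=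
      inv_pos.2 (sub_pos.2 (Real.rpow_lt_one_of_one_lt_of_neg hl1 hs))
    set g := (1 - l ^ ((θ * p - Q) / p))⁻¹
    refine ⟨(C * (l⁻¹ ^ (θ * p - Q) * g ^ p))⁻¹, by positivity, ?_⟩
    intro Z _ _ _ _ ν hν x₀ r R hr hrR hRd
    refine ⟨fun h => absurd h (by linarith), fun h => absurd h (by linarith), fun _ => ?_⟩
    have hR : 0 < R := hr.trans hrR
    obtain ⟨n, h1, h2⟩ := radius hr hrR
    refine le_besovCapacity hν hQ hp hθ hl hlQ hR (by linarith) ((hlM R n).trans_le h2)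
      fun e E he hE h => ?_
    -- The sum stops at `k = n + 1`, whose radius may be below `r` but not below `r / l`; hence the
    -- factor `l⁻¹ ^ (θ * p - Q)` in the constant.
    have hn : r / l ≤ R / l ^ (n + 1) := by
      rw [pow_succ, ← div_div]; gcongr
    have hB := sum_rpow_div_pow_le_of_neg hl1 (div_pos hr hl0) hs hn
    refine le_trans (le_of_eq ?_) (inv_le_of_one_le_sum_rpow hp hC (by positivity)
      (fun k => by positivity) he hE h hB)
    rw [Real.mul_rpow (by positivity) hg.le, ← Real.rpow_mul (by positivity),
      div_mul_cancel₀ _ hp0.ne', div_eq_mul_inv r l, Real.mul_rpow hr.le (by positivity),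
      show Q - θ * p = -(θ * p - Q) by ring, Real.rpow_neg hr.le]
    field_simp
  -- The two terms of `b` absorb `n ≤ log (R / r) / log l` and the extra 2 in `M = n + 2`; the
  -- latter needs `r ≤ R / 2`.
  · have hb : 0 < (Real.log l)⁻¹ + 2 / Real.log 2 := by
      have := Real.log_pos hl1
      have := Real.log_pos one_lt_two
      positivity
    set b := (Real.log l)⁻¹ + 2 / Real.log 2 with hbdef
    refine ⟨(C * b ^ (p - 1))⁻¹, by positivity, ?_⟩
    intro Z _ _ _ _ ν hν x₀ r R hr hrR hRd
    refine ⟨fun h => absurd h (by linarith), fun _ hr2 => ?_, fun h => absurd h (by linarith)⟩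
    have hR : 0 < R := hr.trans hrR
    obtain ⟨n, h1, h2⟩ := radius hr hrR
    refine le_besovCapacity hν hQ hp hθ hl hlQ hR (by linarith) ((hlM R n).trans_le h2)
      fun e E he hE h => ?_
    have hlogl := Real.log_pos hl1
    have hlog2 := Real.log_pos one_lt_two
    have hL2 : Real.log 2 ≤ Real.log (R / r) :=
      Real.log_le_log two_pos ((le_div_iff₀ hr).2 (by linarith))
    have hLn : n * Real.log l ≤ Real.log (R / r) := by
      rw [← Real.log_pow]
      refine Real.log_le_log (by positivity) ?_
      rw [le_div_iff₀ (by positivity)] at h1 ⊢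
      linarith
    have hLpos : 0 < Real.log (R / r) := hlog2.trans_le hL2
    have hM : ((n + 1 + 1 : ℕ) : ℝ) ≤ b * Real.log (R / r) := by
      have h3 : (n : ℝ) ≤ (Real.log l)⁻¹ * Real.log (R / r) := by
        rw [inv_mul_eq_div, le_div_iff₀ hlogl]; exact hLn
      have h4 : 2 ≤ 2 / Real.log 2 * Real.log (R / r) := by
        rw [div_mul_eq_mul_div, le_div_iff₀ hlog2]; linarith
      push_cast
      rw [hbdef, add_mul]
      linarith
    rw [← hCdef, show θ * p - Q = 0 by linarith] at h
    simp only [Real.rpow_zero, mul_one] at h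
    refine le_trans (le_of_eq ?_)
      (inv_le_of_one_le_sum_rpow_inv hp hC he hE (mul_pos hb hLpos) h hM)
    rw [Real.mul_rpow hb.le hLpos.le, show 1 - p = -(p - 1) by ring, Real.rpow_neg hLpos.le]
    field_simp
  · have hs : 0 < (θ * p - Q) / p := div_pos (by linarith) hp0
    have hg : 0 < (1 - l ^ (-((θ * p - Q) / p)))⁻¹ :=
      inv_pos.2 (sub_pos.2 (Real.rpow_lt_one_of_one_lt_of_neg hl1 (by linarith)))
    set g := (1 - l ^ (-((θ * p - Q) / p)))⁻¹
    refine ⟨(C * g ^ p)⁻¹, by positivity, ?_⟩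
    intro Z _ _ _ _ ν hν x₀ r R hr hrR hRd
    refine ⟨fun _ => ?_, fun h => absurd h (by linarith), fun h => absurd h (by linarith)⟩
    have hR : 0 < R := hr.trans hrR
    obtain ⟨n, h1, h2⟩ := radius hr hrR
    refine le_besovCapacity hν hQ hp hθ hl hlQ hR (by linarith) ((hlM R n).trans_le h2)
      fun e E he hE h => ?_
    have hB := sum_rpow_div_pow_le_of_pos hl1 hR hs (n + 1 + 1)
    refine le_trans (le_of_eq ?_) (inv_le_of_one_le_sum_rpow hp hC (by positivity)
      (fun k => by positivity) he hE h hB)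
    rw [Real.mul_rpow (by positivity) hg.le, ← Real.rpow_mul (by positivity),
      div_mul_cancel₀ _ hp0.ne', show Q - θ * p = -(θ * p - Q) by ring, Real.rpow_neg hR.le]
    field_simp
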